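/- Let $\mathbb{N}=\{1,2,3,\dots\}$ and $\omega=\{0,1,2,\dots\}$. For a set $X$ let $\mathcal{P}_f(X)$ be the set of nonempty finite subsets of $X$, and let $\tau$ be the set of all sequences in $\mathbb{N}$. A set $C\subseteq\mathbb{N}$ is a C-set if there are functions $\alpha:\mathcal{P}_f(\tau)\to\mathbb{N}$ and $H:\mathcal{P}_f(\tau)\to\mathcal{P}_f(\mathbb{N})$ such that (1) if $F,G\in\mathcal{P}_f(\tau)$ and $F\subsetneq G$, then $\max H(F)<\min H(G)$; and (2) whenever $m\in\mathbb{N}$, $G_1\subsetneq G_2\subsetneq\cdots\subsetneq G_m$ are in $\mathcal{P}_f(\tau)$ and $f_i\in G_i$ for each $i\in\{1,\dots,m\}$, one has $\sum_{i=1}^{m}\bigl(\alpha(G_i)+\sum_{t\in H(G_i)}f_i(t)\bigr)\in C$. Let $A$ be an $\omega\times\omega$ matrix with rational entries, each of whose rows has only finitely many nonzero entries. $A$ is C-image partition regular if for every C-set $C$ there is $\vec{x}\in\mathbb{N}^{\omega}$ such that all entries of $A\vec{x}$ lie in $C$. $A$ is strongly C-image partition regular if for every C-set $C$ there is $\vec{x}\in\mathbb{N}^{\omega}$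 such that all entries of $\vec{y}=A\vec{x}$ lie in $C$ and, for all $i,j\in\omega$, if row $i$ and row $j$ of $A$ are unequal, then $y_i\neq y_j$. **Corollary.** Let $A_1,A_2,A_3,\dots$ be $\omega\times\omega$ matrices as above, and let $$M=\begin{pmatrix}A_1&0&0&\cdots\\0&A_2&0&\cdots\\0&0&A_3&\cdots\\\vdots&\vdots&\vdots&\ddots\end{pmatrix},$$ regarded as an $\omega\times\omega$ matrix by listing its rows and its columns in type $\omega$, in any order. If every $A_n$ is strongly C-image partition regular, then $M$ is strongly C-image partition regular. If every $A_n$ is C-image partition regular, then $M$ is C-image partition regular. -/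

import Mathlib

/-! Throughout, the set of positive integers is `ℕ+`, while `ℕ` (that is, `ω`) serves as the
index set of sequences, rows, columns and blocks. -/

/-- `Pf X` is the set of nonempty finite subsets of `X`. -/
abbrev Pf (X : Type*) : Type _ := {F : Finset X // F.Nonempty}

/-- C-sets of the semigroup of positive integers under addition. The set of all sequences of
positive integers is `ℕ → ℕ+`. The sums are formed in `ℕ`, because `ℕ+` has no zero; they are sums
over nonempty index sets of positive integers. -/
def IsCSet (C : Set ℕ+) : Prop :=
  ∃ (α : Pf (ℕ → ℕ+) → ℕ+) (H : Pf (ℕ → ℕ+) → Pf ℕ),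
    (∀ F G : Pf (ℕ → ℕ+), F.1 ⊂ G.1 → (H F).1.max' (H F).2 < (H G).1.min' (H G).2) ∧
    (∀ (m : ℕ) (G : Fin m → Pf (ℕ → ℕ+)) (f : Fin m → ℕ → ℕ+), 1 ≤ m →
      (∀ i j : Fin m, i < j → (G i).1 ⊂ (G j).1) →
      (∀ i, f i ∈ (G i).1) →
      ∃ c ∈ C, (c : ℕ) = ∑ i, ((α (G i) : ℕ) + ∑ t ∈ (H (G i)).1, (f i t : ℕ)))

/-- Each row of the `ω × ω` matrix `A` has only finitely many nonzero entries. -/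
def RowFinite (A : Matrix ℕ ℕ ℚ) : Prop :=
  ∀ i, {j | A i j ≠ 0}.Finite

/-- The `i`-th entry of `A x`, for a row-finite matrix `A` and a vector `x` of positive integers. -/
noncomputable def imageEntry (A : Matrix ℕ ℕ ℚ) (x : ℕ → ℕ+) (i : ℕ) : ℚ :=
  ∑ᶠ j, A i j * ((x j : ℕ) : ℚ)

/-- All entries of `A x` belong to `C`. -/
def ImageIn (A : Matrix ℕ ℕ ℚ) (x : ℕ → ℕ+) (C : Set ℕ+) : Prop :=
  ∀ i, ∃ c ∈ C, imageEntry A x i = ((c : ℕ) : ℚ)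

/-- C-image partition regular `ω × ω` matrices. -/
def CImagePartitionRegular (A : Matrix ℕ ℕ ℚ) : Prop :=
  RowFinite A ∧ ∀ C : Set ℕ+, IsCSet C → ∃ x : ℕ → ℕ+, ImageIn A x C

/-- Strongly C-image partition regular `ω × ω` matrices. -/
def StronglyCImagePartitionRegular (A : Matrix ℕ ℕ ℚ) : Prop :=
  RowFinite A ∧ ∀ C : Set ℕ+, IsCSet C → ∃ x : ℕ → ℕ+, ImageIn A x C ∧
    ∀ i j, A.row i ≠ A.row j → imageEntry A x i ≠ imageEntry A x j

/-! For the second claim, solve every block inside the same C-set and concatenate the solutions. For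
strong regularity, entries from different blocks must also differ, so it suffices to solve the
blocks inside pairwise disjoint C-subsets of `C`.

To find these, replace `C` by a decreasing sequence `S` of sets of chain sums
(`IsCSet.exists_filtration`). If every `S n` has elements `d` with `[d, d + N] ⊆ E`, for all `N`,
then adding such a `d` to the shifts pushes all sums into `E`, so `C ∩ E` is again a C-set
(`IsCFiltration.isCSet_inter`). Choosing `d n ∈ S n` that more than double at each step makes the
intervals `[d n, 2 * d n)` disjoint, and distributing them into infinitely many infinite families
gives the disjoint sets `E`. -/

/-- The sum `a + ∑ t ∈ H, f t`. -/
def shiftedSum (a : ℕ+) (H : Pf ℕ) (f : ℕ → ℕ+) : ℕ := (a : ℕ) + ∑ t ∈ H.1, (f t : ℕ)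

/-- The sums along finite chains of finite sets of sequences that all strictly contain `F`. -/
def chainSums (α : Pf (ℕ → ℕ+) → ℕ+) (H : Pf (ℕ → ℕ+) → Pf ℕ) (F : Finset (ℕ → ℕ+)) : Set ℕ :=
  {x | ∃ (m : ℕ) (G : Fin m → Pf (ℕ → ℕ+)) (f : Fin m → ℕ → ℕ+), 1 ≤ m ∧
      (∀ i j : Fin m, i < j → (G i).1 ⊂ (G j).1) ∧ (∀ i, f i ∈ (G i).1) ∧ (∀ i, F ⊂ (G i).1) ∧
      x = ∑ i, shiftedSum (α (G i)) (H (G i)) (f i)}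

theorem chainSums_anti (α : Pf (ℕ → ℕ+) → ℕ+) (H : Pf (ℕ → ℕ+) → Pf ℕ)
    {F F' : Finset (ℕ → ℕ+)} (h : F ⊆ F') : chainSums α H F' ⊆ chainSums α H F := by
  rintro x ⟨m, G, f, hm, hG, hf, hF, hx⟩
  exact ⟨m, G, f, hm, hG, hf, fun i => h.trans_ssubset (hF i), hx⟩

theorem shiftedSum_mem_chainSums (α : Pf (ℕ → ℕ+) → ℕ+) (H : Pf (ℕ → ℕ+) → Pf ℕ)
    {F : Finset (ℕ → ℕ+)} {G : Pf (ℕ → ℕ+)} (hF : F ⊂ G.1) {f : ℕ → ℕ+} (hf : f ∈ G.1) :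
    shiftedSum (α G) (H G) f ∈ chainSums α H F := by
  refine ⟨1, fun _ => G, fun _ => f, le_rfl, ?_, fun _ => hf, fun _ => hF, by simp⟩
  intro i j hij
  exact absurd hij (by simp [Subsingleton.elim i j])

/-- Take for `K` the union of a chain representing `x`: a chain above `K` can be appended to it. -/
theorem exists_add_mem_chainSums (α : Pf (ℕ → ℕ+) → ℕ+) (H : Pf (ℕ → ℕ+) → Pf ℕ)
    {F : Finset (ℕ → ℕ+)} {x : ℕ} (hx : x ∈ chainSums α H F) :
    ∃ K, ∀ y ∈ chainSums α H K, x + y ∈ chainSums α H F := by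
  classical
  obtain ⟨m, G, f, hm, hG, hf, hF, rfl⟩ := hx
  have hK : ∀ i, (G i).1 ⊆ Finset.univ.biUnion fun i => (G i).1 := fun i =>
    Finset.subset_biUnion_of_mem (fun i => (G i).1) (Finset.mem_univ i)
  refine ⟨Finset.univ.biUnion fun i => (G i).1, ?_⟩
  rintro _ ⟨m', G', f', hm', hG', hf', hF', rfl⟩
  refine ⟨m + m', Fin.append G G', Fin.append f f', by omega, ?_, ?_, ?_, ?_⟩
  · intro i j
    refine Fin.addCases (fun i => ?_) (fun i => ?_) i <;>
      refine Fin.addCases (fun j => ?_) (fun j => ?_) j <;> intro hij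
    · simpa using hG i j hij
    · simpa using (hK i).trans_ssubset (hF' j)
    · exfalso
      simp only [Fin.lt_def, Fin.val_natAdd, Fin.val_castAdd] at hij
      omega
    · simpa using hG' i j (Nat.lt_of_add_lt_add_left hij)
  · refine fun i => Fin.addCases (fun i => ?_) (fun i => ?_) i
    · simpa using hf i
    · simpa using hf' i
  · refine fun i => Fin.addCases (fun i => ?_) (fun i => ?_) i
    · simpa using hF i
    · simpa using ((hF ⟨0, hm⟩).trans_subset (hK ⟨0, hm⟩)).trans (hF' i)
  · simp [Fin.sum_univ_add]

theorem exists_ssubset_lt_min' (H : Pf (ℕ → ℕ+) → Pf ℕ)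
    (hH : ∀ F G : Pf (ℕ → ℕ+), F.1 ⊂ G.1 → (H F).1.max' (H F).2 < (H G).1.min' (H G).2)
    (K : Finset (ℕ → ℕ+)) (N : ℕ) : ∃ G : Pf (ℕ → ℕ+), K ⊂ G.1 ∧ N < (H G).1.min' (H G).2 := by
  classical
  have grow : ∀ K : Finset (ℕ → ℕ+), ∃ G : Pf (ℕ → ℕ+), K ⊂ G.1 := fun K => by
    obtain ⟨f, hf⟩ := Infinite.exists_notMem_finset K
    exact ⟨⟨insert f K, Finset.insert_nonempty f K⟩, Finset.ssubset_insert hf⟩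
  induction N with
  | zero =>
    obtain ⟨G, hG⟩ := grow K
    obtain ⟨G', hG'⟩ := grow G.1
    exact ⟨G', hG.trans hG', (Nat.zero_le _).trans_lt (hH G G' hG')⟩
  | succ N ih =>
    obtain ⟨G, hG, hN⟩ := ih
    obtain ⟨G', hG'⟩ := grow G.1
    have h1 := hH G G' hG'
    have h2 := (H G).1.min'_le_max' (H G).2
    exact ⟨G', hG.trans hG', by omega⟩

/-! ### Filtrations and C-subsets -/

/-- A sequence of sets witnessing that `S 0` is a C-set: it decreases, each of its terms is a J-set,
and each `x ∈ S 0` translates a later term, namely `S (x + 1)`, into `S 0`. -/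
structure IsCFiltration (S : ℕ → Set ℕ) : Prop where
  antitone : Antitone S
  add_mem : ∀ x ∈ S 0, ∀ y ∈ S (x + 1), x + y ∈ S 0
  exists_shiftedSum_mem : ∀ (n N : ℕ) (F : Finset (ℕ → ℕ+)), ∃ (a : ℕ+) (H : Pf ℕ),
    (∀ t ∈ H.1, N < t) ∧ ∀ f ∈ F, shiftedSum a H f ∈ S n

theorem IsCSet.exists_filtration {C : Set ℕ+} (hC : IsCSet C) :
    ∃ S : ℕ → Set ℕ, IsCFiltration S ∧ ∀ x ∈ S 0, ∃ c ∈ C, (c : ℕ) = x := by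
  classical
  obtain ⟨α, H, hH, hsum⟩ := hC
  have hK : ∀ x, ∃ K, x ∈ chainSums α H ∅ → ∀ y ∈ chainSums α H K, x + y ∈ chainSums α H ∅ := by
    intro x
    by_cases hx : x ∈ chainSums α H ∅
    · obtain ⟨K, hK⟩ := exists_add_mem_chainSums α H hx
      exact ⟨K, fun _ => hK⟩
    · exact ⟨∅, fun h => absurd h hx⟩
  choose K hK using hK
  have hsub : ∀ n, chainSums α H ((Finset.range n).biUnion K) ⊆ chainSums α H ∅ := fun n =>
    chainSums_anti α H (Finset.empty_subset _)
  refine ⟨fun n => chainSums α H ((Finset.range n).biUnion K), ⟨?_, ?_, ?_⟩, ?_⟩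
  · intro n m hnm
    exact chainSums_anti α H
      (Finset.biUnion_subset_biUnion_of_subset_left K (Finset.range_subset_range.2 hnm))
  · intro x hx y hy
    have hy' : y ∈ chainSums α H (K x) := chainSums_anti α H
      (Finset.subset_biUnion_of_mem K (Finset.mem_range.2 x.lt_succ_self)) hy
    simpa using hK x (by simpa using hx) y hy'
  · intro n N F
    obtain ⟨G, hG, hN⟩ := exists_ssubset_lt_min' H hH ((Finset.range n).biUnion K ∪ F) N
    refine ⟨α G, H G, fun t ht => hN.trans_le (Finset.min'_le _ _ ht), fun f hf => ?_⟩
    exact shiftedSum_mem_chainSums α H (Finset.subset_union_left.trans_ssubset hG)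
      (hG.1 (Finset.mem_union_right _ hf))
  · intro x hx
    obtain ⟨m, G, f, hm, hG, hf, -, rfl⟩ := hsub 0 hx
    exact hsum m G f hm hG hf

theorem IsCFiltration.exists_lt_mem {S : ℕ → Set ℕ} (hS : IsCFiltration S) (n N : ℕ) :
    ∃ d ∈ S n, N < d := by
  obtain ⟨a, H, hN, hmem⟩ := hS.exists_shiftedSum_mem n N {Nat.succPNat}
  refine ⟨_, hmem _ (Finset.mem_singleton_self _), ?_⟩
  obtain ⟨t, ht⟩ := H.2
  have h1 : t + 1 ≤ ∑ t ∈ H.1, ((Nat.succPNat t : ℕ+) : ℕ) :=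
    Finset.single_le_sum (f := fun t => ((Nat.succPNat t : ℕ+) : ℕ)) (fun _ _ => Nat.zero_le _) ht
  have h2 := hN t ht
  unfold shiftedSum
  omega

theorem IsCFiltration.exists_forall_add_mem {S : ℕ → Set ℕ} (hS : IsCFiltration S)
    {Z : Finset ℕ} (hZ : ∀ z ∈ Z, z ∈ S 0) :
    ∃ n, ∀ z ∈ Z, ∀ y ∈ S n, z + y ∈ S 0 :=
  ⟨Z.sup id + 1, fun z hz y hy => hS.add_mem z (hZ z hz) y
    (hS.antitone (Nat.succ_le_succ (Finset.le_sup (f := id) hz)) hy)⟩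

/-- Only finitely many sums `y` are in play, so a single `d` keeps every `y + d` in both `S 0` and
`E`; it is absorbed into the shift. The value `z = 0` serves chains that begin at the new set. -/
theorem IsCFiltration.exists_extension {S : ℕ → Set ℕ} (hS : IsCFiltration S) {E : Set ℕ}
    (hE : ∀ n N, ∃ d ∈ S n, ∀ z ≤ N, z + d ∈ E) {Z : Finset ℕ} (hZ : ∀ z ∈ Z, z ∈ S 0) (N : ℕ)
    (F : Finset (ℕ → ℕ+)) :
    ∃ (a : ℕ+) (H : Pf ℕ), (∀ t ∈ H.1, N < t) ∧
      ∀ f ∈ F, ∀ z ∈ insert 0 Z, z + shiftedSum a H f ∈ S 0 ∩ E := by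
  classical
  obtain ⟨n, hn⟩ := hS.exists_forall_add_mem hZ
  obtain ⟨a, H, hN, hmem⟩ := hS.exists_shiftedSum_mem n N F
  let Y : Finset ℕ := Finset.image₂ (fun z f => z + shiftedSum a H f) (insert 0 Z) F
  have hY : ∀ y ∈ Y, y ∈ S 0 := by
    intro y hy
    obtain ⟨z, hz, f, hf, rfl⟩ := Finset.mem_image₂.1 hy
    rcases Finset.mem_insert.1 hz with rfl | hz
    · simpa using hS.antitone (Nat.zero_le n) (hmem f hf)
    · exact hn z hz _ (hmem f hf)
  obtain ⟨m, hm⟩ := hS.exists_forall_add_mem hY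
  obtain ⟨d, hd, hdE⟩ := hE m (Y.sup id)
  refine ⟨⟨a + d, by have := a.pos; omega⟩, H, hN, fun f hf z hz => ?_⟩
  have hy : z + shiftedSum a H f ∈ Y := Finset.mem_image₂_of_mem hz hf
  have heq : z + shiftedSum ⟨a + d, by have := a.pos; omega⟩ H f = z + shiftedSum a H f + d := by
    simp only [shiftedSum, PNat.mk_coe]
    omega
  rw [heq]
  exact ⟨hm _ hy d hd, hdE _ (Finset.le_sup (f := id) hy)⟩

/-- If `S 0` can be prolonged within `E` from every finite stage, then one may choose shifts,
index sets and finite sets `W G` of sums by recursion on the finite set `G` of sequences. -/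
theorem IsCFiltration.exists_recursive_choice {S : ℕ → Set ℕ} (hS : IsCFiltration S) {E : Set ℕ}
    (hE : ∀ n N, ∃ d ∈ S n, ∀ z ≤ N, z + d ∈ E) :
    ∃ (α : Finset (ℕ → ℕ+) → ℕ+) (H : Finset (ℕ → ℕ+) → Pf ℕ) (W : Finset (ℕ → ℕ+) → Finset ℕ),
      ∀ G, (∀ w ∈ W G, w ∈ S 0 ∩ E) ∧
        (∀ f ∈ G, shiftedSum (α G) (H G) f ∈ W G) ∧
        ∀ G' ⊂ G, (∀ s ∈ (H G').1, ∀ t ∈ (H G).1, s < t) ∧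
          ∀ w ∈ W G', ∀ f ∈ G, w + shiftedSum (α G) (H G) f ∈ W G := by
  classical
  -- Making the choice total, with dummy values, lets the recursion run before its invariant `Z ⊆ S
  -- 0` is proved.
  have pick : ∀ (Z : Finset ℕ) (N : ℕ) (F : Finset (ℕ → ℕ+)), ∃ (a : ℕ+) (H : Pf ℕ),
      (∀ z ∈ Z, z ∈ S 0) → (∀ t ∈ H.1, N < t) ∧
        ∀ f ∈ F, ∀ z ∈ insert 0 Z, z + shiftedSum a H f ∈ S 0 ∩ E := by
    intro Z N F
    by_cases hZ : ∀ z ∈ Z, z ∈ S 0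
    · obtain ⟨a, H, h⟩ := hS.exists_extension hE hZ N F
      exact ⟨a, H, fun _ => h⟩
    · exact ⟨1, ⟨{0}, Finset.singleton_nonempty 0⟩, fun h => absurd h hZ⟩
  choose a H hpick using pick
  let step : ∀ G : Finset (ℕ → ℕ+), (∀ G' ⊂ G, Pf ℕ × Finset ℕ) → ℕ+ × Pf ℕ × Finset ℕ :=
    fun G r =>
      -- `Z` collects all sums, and `N` bounds all indices, used at proper subsets of `G`.
      let Z := G.ssubsets.attach.biUnion fun G' => (r G'.1 (Finset.mem_ssubsets.1 G'.2)).2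
      let N := G.ssubsets.attach.sup fun G' => (r G'.1 (Finset.mem_ssubsets.1 G'.2)).1.1.sup id
      (a Z N G, H Z N G, Finset.image₂ (fun z f => z + shiftedSum (a Z N G) (H Z N G) f)
        (insert 0 Z) G)
  let r : Finset (ℕ → ℕ+) → ℕ+ × Pf ℕ × Finset ℕ :=
    Finset.strongInduction fun G r => step G fun G' h => (r G' h).2
  have hr : ∀ G, r G = step G fun G' _ => (r G').2 := fun G => Finset.strongInduction_eq _ _
  let Z : Finset (ℕ → ℕ+) → Finset ℕ := fun G => G.ssubsets.attach.biUnion fun G' => (r G'.1).2.2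
  let N : Finset (ℕ → ℕ+) → ℕ := fun G => G.ssubsets.attach.sup fun G' => (r G'.1).2.1.1.sup id
  have hr' : ∀ G, r G = (a (Z G) (N G) G, H (Z G) (N G) G,
      Finset.image₂ (fun z f => z + shiftedSum (a (Z G) (N G) G) (H (Z G) (N G) G) f)
        (insert 0 (Z G)) G) := hr
  clear_value r
  have hZ : ∀ {G G' : Finset (ℕ → ℕ+)}, G' ⊂ G → (r G').2.2 ⊆ Z G := fun {G G'} h =>
    Finset.subset_biUnion_of_mem (fun G' : {x // x ∈ G.ssubsets} => (r G'.1).2.2)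
      (Finset.mem_attach _ ⟨G', Finset.mem_ssubsets.2 h⟩)
  have hN : ∀ {G G' : Finset (ℕ → ℕ+)}, G' ⊂ G → (r G').2.1.1.sup id ≤ N G := fun {G G'} h =>
    Finset.le_sup (f := fun G' : {x // x ∈ G.ssubsets} => (r G'.1).2.1.1.sup id)
      (Finset.mem_attach _ ⟨G', Finset.mem_ssubsets.2 h⟩)
  have hW : ∀ G, ∀ w ∈ (r G).2.2, w ∈ S 0 ∩ E := by
    intro G
    induction G using Finset.strongInduction with
    | H G ih =>
      have hZS : ∀ z ∈ Z G, z ∈ S 0 := by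
        intro z hz
        obtain ⟨G', -, hz⟩ := Finset.mem_biUnion.1 hz
        exact (ih G'.1 (Finset.mem_ssubsets.1 G'.2) z hz).1
      intro w hw
      rw [hr' G] at hw
      obtain ⟨z, hz, f, hf, rfl⟩ := Finset.mem_image₂.1 hw
      exact (hpick _ _ _ hZS).2 f hf z hz
  have hZS : ∀ G, ∀ z ∈ Z G, z ∈ S 0 := by
    intro G z hz
    obtain ⟨G', -, hz⟩ := Finset.mem_biUnion.1 hz
    exact (hW _ z hz).1
  refine ⟨fun G => (r G).1, fun G => (r G).2.1, fun G => (r G).2.2, fun G => ⟨hW G, ?_, ?_⟩⟩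
  · intro f hf
    simp only [hr' G]
    exact Finset.mem_image₂.2 ⟨0, Finset.mem_insert_self _ _, f, hf, zero_add _⟩
  · refine fun G' hG' => ⟨fun s hs t ht => ?_, fun w hw f hf => ?_⟩
    · simp only [hr' G] at ht
      exact ((Finset.le_sup (f := id) hs).trans (hN hG')).trans_lt
        ((hpick _ _ _ (hZS G)).1 t ht)
    · simp only [hr' G]
      exact Finset.mem_image₂_of_mem (Finset.mem_insert_of_mem (hZ hG' hw)) hf

theorem IsCFiltration.isCSet_inter {S : ℕ → Set ℕ} (hS : IsCFiltration S) {C : Set ℕ+}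
    (hSC : ∀ x ∈ S 0, ∃ c ∈ C, (c : ℕ) = x) {E : Set ℕ}
    (hE : ∀ n N, ∃ d ∈ S n, ∀ z ≤ N, z + d ∈ E) : IsCSet {c ∈ C | (c : ℕ) ∈ E} := by
  obtain ⟨α, H, W, h⟩ := hS.exists_recursive_choice hE
  refine ⟨fun G => α G.1, fun G => H G.1, fun F G hFG => ?_, fun m G f hm hG hf => ?_⟩
  · exact ((h G.1).2.2 F.1 hFG).1 _ (Finset.max'_mem _ _) _ (Finset.min'_mem _ _)
  · obtain ⟨m, rfl⟩ := Nat.exists_eq_succ_of_ne_zero (Nat.one_le_iff_ne_zero.1 hm)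
    -- `W G` contains every sum along a chain with top `G`.
    have key : ∑ i, shiftedSum (α (G i).1) (H (G i).1) (f i) ∈ W (G (Fin.last m)).1 := by
      clear hm
      induction m with
      | zero => simpa using (h _).2.1 _ (hf 0)
      | succ m ih =>
        rw [Fin.sum_univ_castSucc]
        refine ((h _).2.2 _ (hG (Fin.last m).castSucc _ (Fin.castSucc_lt_last _))).2 _ ?_ _ (hf _)
        exact ih (fun i => G i.castSucc) (fun i => f i.castSucc)
          (fun i j hij => hG _ _ (Fin.castSucc_lt_castSucc_iff.2 hij)) fun i => hf _
    obtain ⟨hmem, hmemE⟩ := (h _).1 _ key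
    obtain ⟨c, hc, hcx⟩ := hSC _ hmem
    exact ⟨c, ⟨hc, by rwa [hcx]⟩, hcx⟩

/-- Every C-set contains infinitely many pairwise disjoint C-sets. -/
theorem IsCSet.exists_pairwise_disjoint {C : Set ℕ+} (hC : IsCSet C) :
    ∃ D : ℕ → Set ℕ+, (∀ n, IsCSet (D n)) ∧ (∀ n, D n ⊆ C) ∧
      Pairwise fun n m => Disjoint (D n) (D m) := by
  obtain ⟨S, hS, hSC⟩ := hC.exists_filtration
  choose e he hlt using hS.exists_lt_mem
  let d : ℕ → ℕ := fun n => Nat.rec (e 0 0) (fun n x => e (n + 1) (2 * x)) n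
  have hdS : ∀ n, d n ∈ S n := by
    rintro (_ | n)
    · exact he _ _
    · exact he _ _
  have hd2 : ∀ n, 2 * d n < d (n + 1) := fun n => hlt (n + 1) (2 * d n)
  have hmono : StrictMono d := strictMono_nat_of_lt_succ fun n => by have := hd2 n; omega
  have hgap : ∀ {i j}, i < j → 2 * d i < d j := fun {i j} hij =>
    (hd2 i).trans_le (hmono.monotone hij)
  refine ⟨fun n => {c ∈ C | (c : ℕ) ∈ {x | ∃ k, d (Nat.pair n k) ≤ x ∧ x < 2 * d (Nat.pair n k)}},
    fun n => hS.isCSet_inter hSC ?_, fun n => Set.sep_subset _ _, ?_⟩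
  · intro m N
    -- The index `p` is at least `m` and `N + 1`, so `d p ∈ S m` and `z ≤ N < p ≤ d p`, whence `z +
    -- d p < 2 * d p`.
    refine ⟨d (Nat.pair n (max m (N + 1))), hS.antitone ?_ (hdS _), fun z hz =>
      ⟨max m (N + 1), by omega, ?_⟩⟩
    · exact (le_max_left _ _).trans (Nat.right_le_pair _ _)
    · have h1 := Nat.right_le_pair n (max m (N + 1))
      have h2 := hmono.le_apply (x := Nat.pair n (max m (N + 1)))
      omega
  · intro n m hnm
    rw [Set.disjoint_left]
    rintro c ⟨-, k, hk1, hk2⟩ ⟨-, l, hl1, hl2⟩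
    rcases lt_trichotomy (Nat.pair n k) (Nat.pair m l) with h | h | h
    · have := hgap h; omega
    · exact hnm (Nat.pair_eq_pair.1 h).1
    · have := hgap h; omega

/-! ### Block-diagonal matrices -/

section BlockDiagonal

variable (A : ℕ → Matrix ℕ ℕ ℚ) (r c : ℕ × ℕ ≃ ℕ)

theorem reindex_blockDiagonal_apply_eq (i n j : ℕ) :
    Matrix.reindex r c (Matrix.blockDiagonal A) (r (i, n)) (c (j, n)) = A n i j := by
  simp

theorem exists_of_reindex_blockDiagonal_ne_zero {i n k : ℕ}
    (h : Matrix.reindex r c (Matrix.blockDiagonal A) (r (i, n)) k ≠ 0) : ∃ j, c (j, n) = k := by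
  refine ⟨(c.symm k).1, ?_⟩
  have hn : n = (c.symm k).2 := by
    by_contra hn
    exact h (by simp [Matrix.blockDiagonal_apply, hn])
  rw [hn, Prod.mk.eta, Equiv.apply_symm_apply]

theorem RowFinite.reindex_blockDiagonal (hA : ∀ n, RowFinite (A n)) :
    RowFinite (Matrix.reindex r c (Matrix.blockDiagonal A)) := by
  intro k
  obtain ⟨⟨i, n⟩, rfl⟩ := r.surjective k
  refine ((hA n i).image fun j => c (j, n)).subset fun l hl => ?_
  obtain ⟨j, rfl⟩ := exists_of_reindex_blockDiagonal_ne_zero A r c hl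
  exact ⟨j, by simpa using hl, rfl⟩

theorem imageEntry_reindex_blockDiagonal (x : ℕ → ℕ → ℕ+) (i n : ℕ) :
    imageEntry (Matrix.reindex r c (Matrix.blockDiagonal A))
      (fun k => x (c.symm k).2 (c.symm k).1) (r (i, n)) = imageEntry (A n) (x n) i := by
  have hinj : Function.Injective fun j => c (j, n) := fun j j' h => by simpa using h
  unfold imageEntry
  rw [← finsum_mem_univ, finsum_mem_inter_support_eq _ _ ( Set.range fun j => c (j, n)),
    finsum_mem_range hinj]
  · simp
  · refine Set.Subset.antisymm (fun k hk => ⟨?_, hk.2⟩) fun k hk => ⟨Set.mem_univ k, hk.2⟩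
    exact exists_of_reindex_blockDiagonal_ne_zero A r c (left_ne_zero_of_mul hk.2)

theorem ImageIn.reindex_blockDiagonal {x : ℕ → ℕ → ℕ+} {C : Set ℕ+}
    (h : ∀ n, ImageIn (A n) (x n) C) :
    ImageIn (Matrix.reindex r c (Matrix.blockDiagonal A))
      (fun k => x (c.symm k).2 (c.symm k).1) C := by
  intro k
  obtain ⟨⟨i, n⟩, rfl⟩ := r.surjective k
  rw [imageEntry_reindex_blockDiagonal]
  exact h n i

theorem StronglyCImagePartitionRegular.reindex_blockDiagonal
    (hA : ∀ n, StronglyCImagePartitionRegular (A n)) :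
    StronglyCImagePartitionRegular (Matrix.reindex r c (Matrix.blockDiagonal A)) := by
  refine ⟨RowFinite.reindex_blockDiagonal A r c fun n => (hA n).1, fun C hC => ?_⟩
  obtain ⟨D, hD, hDC, hdisj⟩ := hC.exists_pairwise_disjoint
  choose x hx hxne using fun n => (hA n).2 (D n) (hD n)
  refine ⟨fun k => x (c.symm k).2 (c.symm k).1, ImageIn.reindex_blockDiagonal A r c fun n i => ?_,
    fun k l hkl => ?_⟩
  · obtain ⟨y, hy, hxy⟩ := hx n i
    exact ⟨y, hDC n hy, hxy⟩
  · obtain ⟨⟨i, n⟩, rfl⟩ := r.surjective k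
    obtain ⟨⟨j, m⟩, rfl⟩ := r.surjective l
    rw [imageEntry_reindex_blockDiagonal, imageEntry_reindex_blockDiagonal]
    by_cases hnm : n = m
    · subst hnm
      refine hxne n i j fun hij => hkl (funext fun k => ?_)
      have hij' : ∀ l, A n i l = A n j l := congrFun hij
      simp [Matrix.row, Matrix.blockDiagonal_apply, hij']
    · intro heq
      obtain ⟨y, hy, hxy⟩ := hx n i
      obtain ⟨z, hz, hxz⟩ := hx m j
      have hyz : y = z := by
        rw [hxy, hxz] at heq
        exact_mod_cast heq
      exact Set.disjoint_left.1 (hdisj hnm) hy (hyz ▸ hz)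

theorem CImagePartitionRegular.reindex_blockDiagonal (hA : ∀ n, CImagePartitionRegular (A n)) :
    CImagePartitionRegular (Matrix.reindex r c (Matrix.blockDiagonal A)) := by
  refine ⟨RowFinite.reindex_blockDiagonal A r c fun n => (hA n).1, fun C hC => ?_⟩
  choose x hx using fun n => (hA n).2 C hC
  exact ⟨_, ImageIn.reindex_blockDiagonal A r c hx⟩

end BlockDiagonal

/-- `Matrix.blockDiagonal A` has its rows and columns indexed by pairs `(i, n)`, where `i` is the
position inside the block `A n`; the bijections `r` and `c` list its rows and its columns as an
`ω × ω` matrix, in an arbitrary order. -/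
theorem corollary2p5 (A : ℕ → Matrix ℕ ℕ ℚ) :
    ((∀ n, StronglyCImagePartitionRegular (A n)) →
      ∀ r c : ℕ × ℕ ≃ ℕ,
        StronglyCImagePartitionRegular (Matrix.reindex r c (Matrix.blockDiagonal A))) ∧
    ((∀ n, CImagePartitionRegular (A n)) →
      ∀ r c : ℕ × ℕ ≃ ℕ,
        CImagePartitionRegular (Matrix.reindex r c (Matrix.blockDiagonal A))) :=
  ⟨fun hA r c => StronglyCImagePartitionRegular.reindex_blockDiagonal A r c hA,
    fun hA r c => CImagePartitionRegular.reindex_blockDiagonal A r c hA⟩
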